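/- Let $X$ be a set of arbitrary cardinality and let $(X,\sigma,\tau)$ be a non-degenerate set-theoretic solution of the Yang--Baxter equation: $r(x,y)=(\sigma_x(y),\tau_y(x))$ is a bijection of $X^2$ satisfying the braid relation $(\mathrm{id}\times r)(r\times \mathrm{id})(\mathrm{id}\times r)=(r\times \mathrm{id})(\mathrm{id}\times r)(r\times \mathrm{id})$, and all $\sigma_x,\tau_y$ are bijections of $X$. Write $r^{-1}(x,y)=(\hat\sigma_x(y),\hat\tau_y(x))$, and let \[ G(X,r)=\langle X\mid x\circ y=\sigma_x(y)\circ\tau_y(x)\rangle,\qquad A(X,r)=\langle X\mid x\cdot y=y\cdot\sigma_y\hat\sigma_y^{-1}(x)\rangle \] be its structure group and its derived group. The group $G(X,r)$ acts on $A(X,r)$ by automorphisms such that $g=x\in X$ sends each generator $y$ to $\sigma_x(y)$, and there is a unique bijection $\pi\colon G(X,r)\to A(X,r)$ that sends each generator $x$ to $x$ and satisfies $\pi(g\circ h)=\pi(g)\cdot g(\pi(h))$. Carrying the multiplication $\cdot$ of $A(X,r)$ over to $G(X,r)$ by $\pi$ makes $(G(X,r),\cdot,\circ)$ a skew left brace,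 i.e. $a\circ(b\cdot c)=(a\circ b)\cdot a^{-1}\cdot(a\circ c)$. For a skew left brace $(B,\cdot,\circ)$ put $\lambda_a(b)=a^{-1}\cdot(a\circ b)$ and $\rho_b(a)=\overline{\lambda_a(b)}\circ a\circ b$, where $a^{-1}$ and $\bar a$ are the inverses of $a$ in $(B,\cdot)$ and $(B,\circ)$, and $\mathrm{Soc}(B)=\{a\in B: a\circ b=a\cdot b=b\cdot a \text{ for all } b\in B\}$. Let $B_0=B$ and $B_{n+1}=B_n/\mathrm{Soc}(B_n)$. The skew left brace $B$ is nilpotent of class $n$ if $n$ is the least number with $|B_n|=1$. Theorem. Suppose that $(X,\sigma,\tau)$ is $2$-reductive, i.e. $\sigma_{\sigma_x(y)}=\sigma_y$, $\tau_{\tau_x(y)}=\tau_y$, $\sigma_{\tau_x(y)}=\sigma_y$ and $\tau_{\sigma_x(y)}=\tau_y$ for all $x,y\in X$. Then the skew left brace $(G(X,r),\cdot,\circ)$ is nilpotent of class at most $2$. Moreover, $\lambda_{a\cdot b}=\lambda_{b\cdot a}=\lambda_{a\circ b}$ and $\rho_{a\cdot b}=\rho_{b\cdot a}=\rho_{a\circ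 b}$ for all $a,b\in G(X,r)$. -/

import Mathlib

universe u

/-! ## Set-theoretic solutions of the Yang-Baxter equation -/

/-- The map `r = (σ, τ) : X² → X²`, `r (x, y) = (σ_x(y), τ_y(x))`. -/
def ybMap {X : Type u} (sigma tau : X → X → X) (p : X × X) : X × X :=
  (sigma p.1 p.2, tau p.2 p.1)

/-- The map `r × id` on `X³`. -/
def ybLeft {X : Type u} (r : X × X → X × X) (p : X × X × X) : X × X × X :=
  ((r (p.1, p.2.1)).1, (r (p.1, p.2.1)).2, p.2.2)

/-- The map `id × r` on `X³`. -/
def ybRight {X : Type u} (r : X × X → X × X) (p : X × X × X) : X × X × X :=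
  (p.1, r p.2)

/-- A (set-theoretic, non-degenerate) solution `(X, σ, τ)` of the Yang-Baxter equation:
`r = (σ, τ)` is a bijection of `X²` satisfying the braid relation. Non-degeneracy, i.e. bijectivity
of all `σ_x` and `τ_y`, is built into the type of `sigma` and `tau`; here `sigma x y = σ_x(y)` and
`tau y x = τ_y(x)`. -/
structure YBSolution (X : Type u) where
  sigma : X → Equiv.Perm X
  tau : X → Equiv.Perm X
  bijective : Function.Bijective (ybMap (fun x y => sigma x y) (fun y x => tau y x))
  braid :
    ybRight (ybMap (fun x y => sigma x y) (fun y x => tau y x)) ∘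
        ybLeft (ybMap (fun x y => sigma x y) (fun y x => tau y x)) ∘
        ybRight (ybMap (fun x y => sigma x y) (fun y x => tau y x)) =
      ybLeft (ybMap (fun x y => sigma x y) (fun y x => tau y x)) ∘
        ybRight (ybMap (fun x y => sigma x y) (fun y x => tau y x)) ∘
        ybLeft (ybMap (fun x y => sigma x y) (fun y x => tau y x))

theorem perm_apply_inv_apply {Y : Type u} (f : Equiv.Perm Y) (y : Y) : f (f⁻¹ y) = y :=
  Equiv.apply_symm_apply f y

namespace YBSolution

variable {X : Type u} (s : YBSolution X)

/-- A solution is 2-reductive if `σ_{σ_x(y)} = σ_y`, `τ_{τ_x(y)} = τ_y`, `σ_{τ_x(y)} = σ_y` and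
`τ_{σ_x(y)} = τ_y` for all `x, y`. -/
def IsTwoReductive : Prop :=
  ∀ x y : X,
    s.sigma (s.sigma x y) = s.sigma y ∧ s.tau (s.tau x y) = s.tau y ∧
    s.sigma (s.tau x y) = s.sigma y ∧ s.tau (s.sigma x y) = s.tau y

/-- The bijection `r : X² → X²`. -/
noncomputable def r : X × X ≃ X × X := Equiv.ofBijective _ s.bijective

theorem r_apply (x y : X) : s.r (x, y) = (s.sigma x y, s.tau y x) := rfl

/-- The permutation `σ̂_x`, where `r⁻¹ (x, y) = (σ̂_x(y), τ̂_y(x))`. -/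
noncomputable def sigmaHat (x : X) : Equiv.Perm X where
  toFun y := (s.r.symm (x, y)).1
  invFun z := s.tau ((s.sigma z).symm x) z
  left_inv y := by
    obtain ⟨⟨a, b⟩, h⟩ := s.r.surjective (x, y)
    have h2 : s.r.symm (x, y) = (a, b) := by rw [← h, Equiv.symm_apply_apply]
    rw [r_apply, Prod.mk.injEq] at h
    obtain ⟨h3, h4⟩ := h
    simp only [h2]
    rw [← h3, Equiv.symm_apply_apply, h4]
  right_inv z := by
    have h : s.r (z, (s.sigma z).symm x) = (x, s.tau ((s.sigma z).symm x) z) := by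
      rw [r_apply, Equiv.apply_symm_apply]
    show (s.r.symm (x, s.tau ((s.sigma z).symm x) z)).1 = z
    rw [← h, Equiv.symm_apply_apply]

theorem sigmaHat_symm_apply (y x : X) :
    (s.sigmaHat y).symm x = s.tau ((s.sigma x).symm y) x := rfl

/-! ### The structure group and the derived structure group -/

/-- The relations `x ∘ y = σ_x(y) ∘ τ_y(x)`. -/
def structureRels : Set (FreeGroup X) :=
  {w | ∃ x y : X, w = (FreeGroup.of x * FreeGroup.of y) *
    (FreeGroup.of (s.sigma x y) * FreeGroup.of (s.tau y x))⁻¹}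

/-- The structure group `G(X, r) = ⟨X ∣ x ∘ y = σ_x(y) ∘ τ_y(x)⟩`. -/
abbrev StructureGroup : Type u := PresentedGroup s.structureRels

/-- The relations `x · y = y · σ_y(σ̂_y⁻¹(x))`. -/
def derivedRels : Set (FreeGroup X) :=
  {w | ∃ x y : X, w = (FreeGroup.of x * FreeGroup.of y) *
    (FreeGroup.of y * FreeGroup.of (s.sigma y ((s.sigmaHat y).symm x)))⁻¹}

/-- The derived group `A(X, r) = ⟨X ∣ x · y = y · σ_y(σ̂_y⁻¹(x))⟩`. -/
abbrev DerivedGroup : Type u := PresentedGroup s.derivedRels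

/-- The canonical map `X → G(X, r)`. -/
def ofG (x : X) : s.StructureGroup := PresentedGroup.of x

/-- The canonical map `X → A(X, r)`. -/
def ofA (x : X) : s.DerivedGroup := PresentedGroup.of x

theorem ofG_rel (x y : X) :
    s.ofG x * s.ofG y = s.ofG (s.sigma x y) * s.ofG (s.tau y x) := by
  have h := PresentedGroup.one_of_mem (rels := s.structureRels) ⟨x, y, rfl⟩
  rw [map_mul, map_inv, mul_inv_eq_one, map_mul, map_mul] at h
  exact h

theorem ofA_rel (x y : X) :
    s.ofA x * s.ofA y = s.ofA y * s.ofA (s.sigma y ((s.sigmaHat y).symm x)) := by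
  have h := PresentedGroup.one_of_mem (rels := s.derivedRels) ⟨x, y, rfl⟩
  rw [map_mul, map_inv, mul_inv_eq_one, map_mul, map_mul] at h
  exact h

/-- Homomorphisms out of `G(X, r)`. -/
def liftG {H : Type*} [Group H] (f : X → H)
    (hf : ∀ x y, f x * f y = f (s.sigma x y) * f (s.tau y x)) : s.StructureGroup →* H :=
  PresentedGroup.toGroup (f := f) (by
    rintro _ ⟨x, y, rfl⟩
    simp [hf x y])

theorem liftG_of {H : Type*} [Group H] (f : X → H)
    (hf : ∀ x y, f x * f y = f (s.sigma x y) * f (s.tau y x)) (x : X) :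
    s.liftG f hf (s.ofG x) = f x := PresentedGroup.toGroup.of _

/-- Homomorphisms out of `A(X, r)`. -/
def liftA {H : Type*} [Group H] (f : X → H)
    (hf : ∀ x y, f x * f y = f y * f (s.sigma y ((s.sigmaHat y).symm x))) :
    s.DerivedGroup →* H :=
  PresentedGroup.toGroup (f := f) (by
    rintro _ ⟨x, y, rfl⟩
    simp [hf x y])

theorem liftA_of {H : Type*} [Group H] (f : X → H)
    (hf : ∀ x y, f x * f y = f y * f (s.sigma y ((s.sigmaHat y).symm x))) (x : X) :
    s.liftA f hf (s.ofA x) = f x := PresentedGroup.toGroup.of _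

theorem inductionG {P : s.StructureGroup → Prop} (hof : ∀ x, P (s.ofG x))
    (hone : P 1) (hmul : ∀ a b, P a → P b → P (a * b)) (hinv : ∀ a, P a → P a⁻¹)
    (a : s.StructureGroup) : P a := by
  have h : a ∈ Subgroup.closure (Set.range (PresentedGroup.of (rels := s.structureRels))) := by
    rw [PresentedGroup.closure_range_of]; trivial
  induction h using Subgroup.closure_induction with
  | mem x hx => obtain ⟨y, rfl⟩ := hx; exact hof y
  | one => exact hone
  | mul a b _ _ ha hb => exact hmul a b ha hb
  | inv a _ ha => exact hinv a ha

theorem inductionA {P : s.DerivedGroup → Prop} (hof : ∀ x, P (s.ofA x))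
    (hone : P 1) (hmul : ∀ a b, P a → P b → P (a * b)) (hinv : ∀ a, P a → P a⁻¹)
    (a : s.DerivedGroup) : P a := by
  have h : a ∈ Subgroup.closure (Set.range (PresentedGroup.of (rels := s.derivedRels))) := by
    rw [PresentedGroup.closure_range_of]; trivial
  induction h using Subgroup.closure_induction with
  | mem x hx => obtain ⟨y, rfl⟩ := hx; exact hof y
  | one => exact hone
  | mul a b _ _ ha hb => exact hmul a b ha hb
  | inv a _ ha => exact hinv a ha

/-! ### Consequences of the braid relation -/

theorem braid_apply (x y z : X) :
    s.sigma x (s.sigma y z) = s.sigma (s.sigma x y) (s.sigma (s.tau y x) z) ∧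
    s.sigma (s.tau (s.sigma y z) x) (s.tau z y) =
      s.tau (s.sigma (s.tau y x) z) (s.sigma x y) ∧
    s.tau (s.tau z y) (s.tau (s.sigma y z) x) = s.tau z (s.tau y x) := by
  have h := congrFun s.braid (x, y, z)
  simp only [Function.comp_apply, ybRight, ybLeft, ybMap, Prod.mk.injEq] at h
  exact h

theorem sigma_mul (x y : X) :
    s.sigma x * s.sigma y = s.sigma (s.sigma x y) * s.sigma (s.tau y x) := by
  ext z
  exact (s.braid_apply x y z).1

theorem derived_equivariant (a x y : X) :
    s.sigma a (s.sigma y ((s.sigmaHat y).symm x)) =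
      s.sigma (s.sigma a y) ((s.sigmaHat (s.sigma a y)).symm (s.sigma a x)) := by
  obtain ⟨c, rfl⟩ := (s.sigma x).surjective y
  simp only [sigmaHat_symm_apply, Equiv.symm_apply_apply]
  have h1 := (s.braid_apply a x c).1
  have h2 := (s.braid_apply a x c).2.1
  have h3 : (s.sigma (s.sigma a x)).symm (s.sigma a (s.sigma x c)) = s.sigma (s.tau x a) c := by
    rw [h1, Equiv.symm_apply_apply]
  rw [h3, ← h2]
  exact (s.braid_apply a (s.sigma x c) (s.tau c x)).1

theorem derived_equivariant_symm (a x y : X) :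
    (s.sigma a).symm (s.sigma y ((s.sigmaHat y).symm x)) =
      s.sigma ((s.sigma a).symm y)
        ((s.sigmaHat ((s.sigma a).symm y)).symm ((s.sigma a).symm x)) := by
  rw [Equiv.symm_apply_eq, derived_equivariant, Equiv.apply_symm_apply, Equiv.apply_symm_apply]

/-- The map `z ↦ σ_z⁻¹(z)` is a bijection. -/
def diag : Equiv.Perm X where
  toFun z := (s.sigma z).symm z
  invFun w := s.sigma ((s.tau w).symm w) w
  left_inv z := by
    show s.sigma ((s.tau ((s.sigma z).symm z)).symm ((s.sigma z).symm z))
      ((s.sigma z).symm z) = z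
    have right : ∀ w, (s.sigma (s.sigma ((s.tau w).symm w) w)).symm
        (s.sigma ((s.tau w).symm w) w) = w := by
      intro w
      have h := s.sigma_mul ((s.tau w).symm w) w
      rw [Equiv.apply_symm_apply, mul_left_inj] at h
      rw [← h, Equiv.symm_apply_apply]
    have key : ∀ z w, s.sigma z w = z →
        s.tau w z = s.sigma w (s.tau ((s.sigma w).symm w) w) := by
      intro z w h
      have h1 := s.sigma_mul z w
      rw [h, mul_right_inj] at h1
      have h2 := (s.braid_apply z w ((s.sigma w).symm w)).2.1
      rw [← h1, Equiv.apply_symm_apply, h] at h2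
      have h3 := s.sigma_mul z w
      rw [← h2]
      have h4 : s.tau w z = s.sigma (s.tau w z) (s.tau ((s.sigma w).symm w) w) := h2.symm
      rw [← h1] at h4
      rw [h2]
      exact h4
    have e1 : s.sigma z ((s.sigma z).symm z) = z := Equiv.apply_symm_apply _ _
    generalize (s.sigma z).symm z = w at *
    have e2 := right w
    rw [Equiv.symm_apply_eq] at e2
    have k1 := key z w e1
    have k2 := key _ w e2.symm
    exact (s.tau w).injective (k2.trans k1.symm)
  right_inv w := by
    have h := s.sigma_mul ((s.tau w).symm w) w
    rw [Equiv.apply_symm_apply, mul_left_inj] at h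
    show (s.sigma (s.sigma ((s.tau w).symm w) w)).symm (s.sigma ((s.tau w).symm w) w) = w
    rw [← h, Equiv.symm_apply_apply]

/-! ### The bijection between `G(X, r)` and `A(X, r)` -/

/-- The action of `G(X, r)` on `X` extending `x ↦ σ_x`. -/
def sigmaHom : s.StructureGroup →* Equiv.Perm X := s.liftG s.sigma s.sigma_mul

theorem sigmaHom_of (x : X) : s.sigmaHom (s.ofG x) = s.sigma x := s.liftG_of _ _ x

/-- `σ_x` extended to an endomorphism of `A(X, r)`. -/
def sigmaEnd (x : X) : s.DerivedGroup →* s.DerivedGroup :=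
  s.liftA (fun y => s.ofA (s.sigma x y)) (fun a b => by
    rw [s.derived_equivariant]; exact s.ofA_rel _ _)

theorem sigmaEnd_of (x y : X) : s.sigmaEnd x (s.ofA y) = s.ofA (s.sigma x y) :=
  s.liftA_of _ _ y

/-- `σ_x⁻¹` extended to an endomorphism of `A(X, r)`. -/
def sigmaEndInv (x : X) : s.DerivedGroup →* s.DerivedGroup :=
  s.liftA (fun y => s.ofA ((s.sigma x).symm y)) (fun a b => by
    rw [s.derived_equivariant_symm]; exact s.ofA_rel _ _)

theorem sigmaEndInv_of (x y : X) : s.sigmaEndInv x (s.ofA y) = s.ofA ((s.sigma x).symm y) :=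
  s.liftA_of _ _ y

/-- `σ_x` extended to an automorphism of `A(X, r)`. -/
def sigmaAut (x : X) : MulAut s.DerivedGroup :=
  MonoidHom.toMulEquiv (s.sigmaEnd x) (s.sigmaEndInv x)
    (by
      ext y
      change s.sigmaEndInv x (s.sigmaEnd x (s.ofA y)) = s.ofA y
      rw [sigmaEnd_of, sigmaEndInv_of, Equiv.symm_apply_apply])
    (by
      ext y
      change s.sigmaEnd x (s.sigmaEndInv x (s.ofA y)) = s.ofA y
      rw [sigmaEndInv_of, sigmaEnd_of, Equiv.apply_symm_apply])

theorem sigmaAut_of (x y : X) : s.sigmaAut x (s.ofA y) = s.ofA (s.sigma x y) :=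
  s.sigmaEnd_of x y

/-- The action of `G(X, r)` on `A(X, r)` by automorphisms extending `x ↦ σ_x`. -/
noncomputable def actHom : s.StructureGroup →* MulAut s.DerivedGroup :=
  s.liftG s.sigmaAut (fun x y => by
    apply MulEquiv.toMonoidHom_injective
    ext z
    show s.sigmaAut x (s.sigmaAut y (s.ofA z)) =
      s.sigmaAut (s.sigma x y) (s.sigmaAut (s.tau y x) (s.ofA z))
    simp only [sigmaAut_of]
    rw [(s.braid_apply x y z).1])

theorem actHom_of (x : X) : s.actHom (s.ofG x) = s.sigmaAut x := s.liftG_of _ _ x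

theorem actHom_apply_of (g : s.StructureGroup) (y : X) :
    s.actHom g (s.ofA y) = s.ofA (s.sigmaHom g y) := by
  revert y
  refine s.inductionG (P := fun g => ∀ y, s.actHom g (s.ofA y) = s.ofA (s.sigmaHom g y))
    ?_ ?_ ?_ ?_ g
  · intro x y
    rw [actHom_of, sigmaHom_of, sigmaAut_of]
  · intro y
    simp
  · intro a b ha hb y
    rw [map_mul, map_mul, MulAut.mul_apply, hb, ha, Equiv.Perm.mul_apply]
  · intro a ha y
    rw [map_inv, map_inv, MulAut.inv_apply, MulEquiv.symm_apply_eq, ha, perm_apply_inv_apply]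

/-- The homomorphism `G(X, r) → A(X, r) ⋊ Aut(A(X, r))` with `x ↦ (x, σ_x)`. -/
noncomputable def affineHom :
    s.StructureGroup →* s.DerivedGroup ⋊[MonoidHom.id (MulAut s.DerivedGroup)]
      MulAut s.DerivedGroup :=
  s.liftG (fun x => ⟨s.ofA x, s.sigmaAut x⟩) (fun x y => by
    ext1
    · show s.ofA x * s.sigmaAut x (s.ofA y) =
        s.ofA (s.sigma x y) * s.sigmaAut (s.sigma x y) (s.ofA (s.tau y x))
      rw [sigmaAut_of, sigmaAut_of, ofA_rel, sigmaHat_symm_apply, Equiv.symm_apply_apply]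
    · show s.sigmaAut x * s.sigmaAut y = s.sigmaAut (s.sigma x y) * s.sigmaAut (s.tau y x)
      rw [← actHom_of, ← actHom_of, ← actHom_of, ← actHom_of, ← map_mul, ← map_mul, ofG_rel])

theorem affineHom_of (x : X) : s.affineHom (s.ofG x) = ⟨s.ofA x, s.sigmaAut x⟩ :=
  s.liftG_of _ _ x

theorem affineHom_right (g : s.StructureGroup) : (s.affineHom g).right = s.actHom g := by
  refine s.inductionG (P := fun g => (s.affineHom g).right = s.actHom g) ?_ ?_ ?_ ?_ g
  · intro x
    rw [affineHom_of, actHom_of]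
  · simp
  · intro a b ha hb
    rw [map_mul, map_mul, SemidirectProduct.mul_right, ha, hb]
  · intro a ha
    rw [map_inv, map_inv, SemidirectProduct.inv_right, ha]

/-- The bijective 1-cocycle `G(X, r) → A(X, r)` which is the identity on `X`. -/
noncomputable def cocycle (g : s.StructureGroup) : s.DerivedGroup := (s.affineHom g).left

theorem cocycle_of (x : X) : s.cocycle (s.ofG x) = s.ofA x := by
  rw [cocycle, affineHom_of]

theorem cocycle_mul (g h : s.StructureGroup) :
    s.cocycle (g * h) = s.cocycle g * s.actHom g (s.cocycle h) := by
  rw [cocycle, map_mul, SemidirectProduct.mul_left, affineHom_right]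
  rfl

theorem cocycle_one : s.cocycle 1 = 1 := by
  rw [cocycle, map_one]; rfl

/-- The permutation `g ↦ g ∘ σ_g⁻¹(y)` of `G(X, r)`, which is `g ↦ g · y`. -/
def transl (y : X) : Equiv.Perm s.StructureGroup where
  toFun g := g * s.ofG ((s.sigmaHom g).symm y)
  invFun h := h * (s.ofG (s.diag.symm ((s.sigmaHom h).symm y)))⁻¹
  left_inv g := by
    have h : (s.sigmaHom (g * s.ofG ((s.sigmaHom g).symm y))).symm y =
        s.diag ((s.sigmaHom g).symm y) := by
      rw [map_mul, sigmaHom_of]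
      rfl
    simp only [h, Equiv.symm_apply_apply, mul_inv_cancel_right]
  right_inv h := by
    have hz : (s.sigmaHom (h * (s.ofG (s.diag.symm ((s.sigmaHom h).symm y)))⁻¹)).symm y =
        s.diag.symm ((s.sigmaHom h).symm y) := by
      obtain ⟨z, hz⟩ := s.diag.surjective ((s.sigmaHom h).symm y)
      rw [← hz, Equiv.symm_apply_apply, map_mul, map_inv, sigmaHom_of]
      show s.sigma z ((s.sigmaHom h).symm y) = z
      rw [← hz]
      exact Equiv.apply_symm_apply _ _
    simp only [hz, inv_mul_cancel_right]

theorem transl_apply (y : X) (g : s.StructureGroup) :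
    s.transl y g = g * s.ofG ((s.sigmaHom g).symm y) := rfl

theorem derived_equivariant_hom (g : s.StructureGroup) (x y : X) :
    (s.sigmaHom g).symm (s.sigma y ((s.sigmaHat y).symm x)) =
      s.sigma ((s.sigmaHom g).symm y)
        ((s.sigmaHat ((s.sigmaHom g).symm y)).symm ((s.sigmaHom g).symm x)) := by
  rw [Equiv.symm_apply_eq]
  revert x y
  suffices H : ∀ x y, s.sigmaHom g (s.sigma y ((s.sigmaHat y).symm x)) =
      s.sigma (s.sigmaHom g y) ((s.sigmaHat (s.sigmaHom g y)).symm (s.sigmaHom g x)) by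
    intro x y
    rw [H, Equiv.apply_symm_apply, Equiv.apply_symm_apply]
  refine s.inductionG (P := fun g => ∀ x y, s.sigmaHom g (s.sigma y ((s.sigmaHat y).symm x)) =
      s.sigma (s.sigmaHom g y) ((s.sigmaHat (s.sigmaHom g y)).symm (s.sigmaHom g x)))
    ?_ ?_ ?_ ?_ g
  · intro a x y
    rw [sigmaHom_of, derived_equivariant]
  · intro x y
    simp
  · intro a b ha hb x y
    rw [map_mul, Equiv.Perm.mul_apply, hb, ha]
    rfl
  · intro a ha x y
    rw [map_inv, Equiv.Perm.inv_eq_iff_eq, ha, perm_apply_inv_apply,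
      perm_apply_inv_apply]

/-- The right action of `A(X, r)` on the set `G(X, r)`. -/
def translHom : s.DerivedGroup →* (Equiv.Perm s.StructureGroup)ᵐᵒᵖ :=
  s.liftA (fun y => MulOpposite.op (s.transl y)) (fun x y => by
    rw [← MulOpposite.op_mul, ← MulOpposite.op_mul]
    congr 1
    ext g
    rw [Equiv.Perm.mul_apply, Equiv.Perm.mul_apply]
    simp only [transl_apply, map_mul, sigmaHom_of]
    show g * _ * s.ofG ((s.sigma ((s.sigmaHom g).symm x)).symm ((s.sigmaHom g).symm y)) =
      g * _ * s.ofG ((s.sigma ((s.sigmaHom g).symm y)).symm ((s.sigmaHom g).symm _))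
    rw [derived_equivariant_hom, Equiv.symm_apply_apply, mul_assoc, mul_assoc, ofG_rel,
      Equiv.apply_symm_apply, sigmaHat_symm_apply])

theorem translHom_of (y : X) : (s.translHom (s.ofA y)).unop = s.transl y := by
  rw [translHom, liftA_of, MulOpposite.unop_op]

theorem cocycle_transl (a : s.DerivedGroup) (g : s.StructureGroup) :
    s.cocycle ((s.translHom a).unop g) = s.cocycle g * a := by
  revert g
  refine s.inductionA (P := fun a => ∀ g, s.cocycle ((s.translHom a).unop g) = s.cocycle g * a)
    ?_ ?_ ?_ ?_ a
  · intro y g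
    rw [translHom_of, transl_apply, cocycle_mul, cocycle_of, actHom_apply_of,
      Equiv.apply_symm_apply]
  · intro g
    simp
  · intro a b ha hb g
    rw [map_mul, MulOpposite.unop_mul, Equiv.Perm.mul_apply, hb, ha, mul_assoc]
  · intro a ha g
    have h := ha ((s.translHom a⁻¹).unop g)
    rw [map_inv, MulOpposite.unop_inv, perm_apply_inv_apply] at h
    rw [map_inv, MulOpposite.unop_inv, h, mul_inv_cancel_right]

theorem transl_cocycle (h g : s.StructureGroup) :
    (s.translHom (s.actHom g (s.cocycle h))).unop g = g * h := by
  revert g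
  refine s.inductionG (P := fun h => ∀ g,
    (s.translHom (s.actHom g (s.cocycle h))).unop g = g * h) ?_ ?_ ?_ ?_ h
  · intro x g
    rw [cocycle_of, actHom_apply_of, translHom_of, transl_apply, Equiv.symm_apply_apply]
  · intro g
    rw [cocycle_one]
    simp
  · intro a b ha hb g
    rw [cocycle_mul, map_mul, map_mul, MulOpposite.unop_mul, Equiv.Perm.mul_apply, ha,
      ← MulAut.mul_apply, ← map_mul, hb, mul_assoc]
  · intro a ha g
    have h1 : s.cocycle a⁻¹ = (s.actHom a⁻¹ (s.cocycle a))⁻¹ := by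
      rw [eq_inv_iff_mul_eq_one, ← cocycle_mul, inv_mul_cancel, cocycle_one]
    have h2 := ha (g * a⁻¹)
    rw [inv_mul_cancel_right, map_mul s.actHom, MulAut.mul_apply] at h2
    rw [h1, map_inv, map_inv, MulOpposite.unop_inv, Equiv.Perm.inv_eq_iff_eq, h2]

/-- The canonical bijection `G(X, r) → A(X, r)`, `x ↦ x`. -/
noncomputable def toDerived : s.StructureGroup ≃ s.DerivedGroup where
  toFun := s.cocycle
  invFun a := (s.translHom a).unop 1
  left_inv g := by
    have h := s.transl_cocycle g 1
    rwa [map_one s.actHom, MulAut.one_apply, one_mul] at h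
  right_inv a := by
    rw [cocycle_transl, cocycle_one, one_mul]

theorem toDerived_of (x : X) : s.toDerived (s.ofG x) = s.ofA x := s.cocycle_of x

theorem toDerived_mul (g h : s.StructureGroup) :
    s.toDerived (g * h) = s.toDerived g * s.actHom g (s.toDerived h) := s.cocycle_mul g h

end YBSolution

/-! ## Skew left braces -/

/-- A skew left brace `(B, ·, ∘)`: two group structures on `B` with
`a ∘ (b · c) = (a ∘ b) · a⁻¹ · (a ∘ c)`. -/
structure SkewLeftBrace (B : Type u) where
  dotGroup : Group B
  circGroup : Group B
  compat : ∀ a b c : B,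
    circGroup.mul a (dotGroup.mul b c) =
      dotGroup.mul (dotGroup.mul (circGroup.mul a b) (dotGroup.inv a)) (circGroup.mul a c)

namespace SkewLeftBrace

variable {B : Type u} (S : SkewLeftBrace B)

/-- `a · b` -/
def dot (a b : B) : B := S.dotGroup.mul a b

/-- `a ∘ b` -/
def circ (a b : B) : B := S.circGroup.mul a b

/-- The inverse `a⁻¹` in `(B, ·)`. -/
def dotInv (a : B) : B := S.dotGroup.inv a

/-- The inverse `ā` in `(B, ∘)`. -/
def circInv (a : B) : B := S.circGroup.inv a

/-- The neutral element of `(B, ·)`. -/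
def unit : B := S.dotGroup.one

theorem dot_assoc (a b c : B) : S.dot (S.dot a b) c = S.dot a (S.dot b c) :=
  S.dotGroup.mul_assoc a b c

theorem circ_assoc (a b c : B) : S.circ (S.circ a b) c = S.circ a (S.circ b c) :=
  S.circGroup.mul_assoc a b c

theorem unit_dot (a : B) : S.dot S.unit a = a := S.dotGroup.one_mul a

theorem dot_unit (a : B) : S.dot a S.unit = a := S.dotGroup.mul_one a

theorem dotInv_dot (a : B) : S.dot (S.dotInv a) a = S.unit := S.dotGroup.inv_mul_cancel a

theorem dot_dotInv (a : B) : S.dot a (S.dotInv a) = S.unit :=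
  letI := S.dotGroup
  mul_inv_cancel a

theorem dot_cancel {a b c : B} (h : S.dot a b = S.dot a c) : b = c :=
  letI := S.dotGroup
  mul_left_cancel (a := a) h

theorem dot_cancel_right {a b c : B} (h : S.dot b a = S.dot c a) : b = c :=
  letI := S.dotGroup
  mul_right_cancel (b := a) h

theorem circ_cancel {a b c : B} (h : S.circ a b = S.circ a c) : b = c :=
  letI := S.circGroup
  mul_left_cancel (a := a) h

theorem circ_dot (a b c : B) :
    S.circ a (S.dot b c) = S.dot (S.dot (S.circ a b) (S.dotInv a)) (S.circ a c) :=
  S.compat a b c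

/-- `λ_a(b) = a⁻¹ · (a ∘ b)` -/
def lam (a b : B) : B := S.dot (S.dotInv a) (S.circ a b)

/-- `ρ_y(x)`, the `∘`-product of the `∘`-inverse of `λ_x(y)` with `x ∘ y`; as a function of two
arguments, `rho y x = ρ_y(x)`. -/
def rho (y x : B) : B := S.circ (S.circInv (S.lam x y)) (S.circ x y)

/-- The socle `Soc(B) = {a ∣ a ∘ b = a · b = b · a for all b}`. -/
def socle : Set B := {a | ∀ b, S.circ a b = S.dot a b ∧ S.dot a b = S.dot b a}

theorem circ_eq (a b : B) : S.circ a b = S.dot a (S.lam a b) := by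
  rw [lam, ← dot_assoc, dot_dotInv, unit_dot]

theorem lam_dot (a b c : B) : S.lam a (S.dot b c) = S.dot (S.lam a b) (S.lam a c) := by
  simp only [lam, circ_dot, dot_assoc]

theorem lam_circ (a b c : B) : S.lam (S.circ a b) c = S.lam a (S.lam b c) := by
  apply S.dot_cancel (a := S.circ a b)
  rw [← circ_eq, circ_assoc, S.circ_eq b c, S.circ_eq a (S.dot b _), lam_dot, ← dot_assoc,
    ← circ_eq]

theorem lam_injective (a : B) : Function.Injective (S.lam a) := fun _ _ h =>
  S.circ_cancel (a := a) (by rw [circ_eq, circ_eq, h])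

theorem unit_circ (b : B) : S.circ S.unit b = b := by
  have h : ∀ a : B, S.circ a S.unit = a := fun a => by
    have h1 := S.circ_dot a S.unit S.unit
    rw [unit_dot, dot_assoc] at h1
    have h2 : S.dot (S.circ a S.unit) S.unit =
        S.dot (S.circ a S.unit) (S.dot (S.dotInv a) (S.circ a S.unit)) := by
      rw [dot_unit]; exact h1
    have h3 := S.dot_cancel h2
    have h4 : S.dot a S.unit = S.dot a (S.dot (S.dotInv a) (S.circ a S.unit)) := by rw [← h3]
    rw [← dot_assoc, dot_dotInv, unit_dot, dot_unit] at h4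
    exact h4.symm
  apply S.circ_cancel (a := S.unit)
  rw [← circ_assoc, h]

theorem lam_surjective (a : B) : Function.Surjective (S.lam a) := fun b =>
  ⟨S.lam (S.circInv a) b, by
    have h : S.circ a (S.circInv a) = S.unit := by
      have h1 : S.circ (S.circ a (S.circInv a)) S.unit = S.unit := by
        let := S.circGroup
        show a * a⁻¹ * S.unit = S.unit
        rw [mul_inv_cancel, one_mul]
      have h2 : S.circ S.unit S.unit = S.unit := S.unit_circ _
      have h3 : S.circ (S.circ a (S.circInv a)) S.unit = S.circ S.unit S.unit := h1.trans h2.symm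
      let := S.circGroup
      exact mul_right_cancel (b := S.unit) h3
    rw [← lam_circ, h]
    apply S.dot_cancel (a := S.unit)
    rw [← circ_eq, unit_dot, unit_circ]⟩

theorem unit_mem_socle : S.unit ∈ S.socle := fun b =>
  ⟨by rw [unit_circ, unit_dot], by rw [unit_dot, dot_unit]⟩

theorem dot_mem_socle {a b : B} (ha : a ∈ S.socle) (hb : b ∈ S.socle) :
    S.dot a b ∈ S.socle := fun c => by
  refine ⟨?_, ?_⟩
  · rw [← (ha b).1, circ_assoc, (ha _).1, (hb c).1, (ha b).1, dot_assoc]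
  · rw [dot_assoc, (hb c).2, ← dot_assoc, (ha c).2, dot_assoc]

theorem dotInv_mem_socle {a : B} (ha : a ∈ S.socle) : S.dotInv a ∈ S.socle := fun b => by
  have hc : S.circ a (S.dotInv a) = S.unit := by rw [(ha _).1, dot_dotInv]
  refine ⟨?_, ?_⟩
  · apply S.circ_cancel (a := a)
    rw [← circ_assoc, hc, unit_circ, (ha _).1, ← dot_assoc, dot_dotInv, unit_dot]
  · apply S.dot_cancel (a := a)
    rw [← dot_assoc, dot_dotInv, unit_dot, (ha _).2, dot_assoc, dotInv_dot, dot_unit]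

theorem lam_mem_socle {t : B} (ht : t ∈ S.socle) (a : B) : S.lam a t ∈ S.socle := by
  have hcen : ∀ b, S.dot (S.lam a t) b = S.dot b (S.lam a t) := fun b => by
    obtain ⟨c, rfl⟩ := S.lam_surjective a b
    rw [← lam_dot, ← lam_dot, (ht c).2]
  have hta : S.circ a t = S.circ (S.circ (S.circ a t) (S.circInv a)) a := by
    let := S.circGroup
    exact (inv_mul_cancel_right (a * t) a).symm
  have hlamt : ∀ c, S.lam t c = c := fun c => by
    apply S.dot_cancel (a := t)
    rw [← circ_eq, (ht c).1]
  have hlamu : ∀ c, S.lam (S.circ (S.circ a t) (S.circInv a)) c = c := fun c => by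
    rw [lam_circ, lam_circ, hlamt, ← lam_circ]
    obtain ⟨d, rfl⟩ := S.lam_surjective a c
    rw [← lam_circ]
    congr 1
    let := S.circGroup
    exact inv_mul_cancel_right a a
  have hu : S.circ (S.circ a t) (S.circInv a) = S.lam a t := by
    apply S.dot_cancel_right (a := a)
    rw [hcen, ← circ_eq]
    have h1 := S.circ_eq (S.circ (S.circ a t) (S.circInv a)) a
    rw [hlamu] at h1
    rw [← h1]
    exact hta.symm
  intro b
  refine ⟨?_, hcen b⟩
  rw [circ_eq, ← hu, hlamu]

/-- Two elements are equivalent if they lie in the same coset of the socle. -/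
def socleSetoid : Setoid B where
  r a b := S.dot (S.dotInv a) b ∈ S.socle
  iseqv :=
    { refl := fun a => by rw [dotInv_dot]; exact S.unit_mem_socle
      symm := fun {a b} h => by
        have h2 := S.dotInv_mem_socle h
        have h3 : S.dotInv (S.dot (S.dotInv a) b) = S.dot (S.dotInv b) a := by
          let := S.dotGroup
          show (a⁻¹ * b)⁻¹ = b⁻¹ * a
          group
        rwa [h3] at h2
      trans := fun {a b c} h1 h2 => by
        have h3 := S.dot_mem_socle h1 h2
        have h4 : S.dot (S.dot (S.dotInv a) b) (S.dot (S.dotInv b) c) = S.dot (S.dotInv a) c := by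
          let := S.dotGroup
          show (a⁻¹ * b) * (b⁻¹ * c) = a⁻¹ * c
          group
        rwa [h4] at h3 }

theorem socle_rel_iff {a b : B} : S.socleSetoid.r a b ↔ ∃ t ∈ S.socle, b = S.dot a t := by
  constructor
  · intro h
    exact ⟨_, h, by rw [← dot_assoc, dot_dotInv, unit_dot]⟩
  · rintro ⟨t, ht, rfl⟩
    show S.dot (S.dotInv a) (S.dot a t) ∈ S.socle
    rwa [← dot_assoc, dotInv_dot, unit_dot]

theorem socle_rel_dot {a b c d : B} (h1 : S.socleSetoid.r a b) (h2 : S.socleSetoid.r c d) :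
    S.socleSetoid.r (S.dot a c) (S.dot b d) := by
  rw [socle_rel_iff] at *
  obtain ⟨t, ht, rfl⟩ := h1
  obtain ⟨v, hv, rfl⟩ := h2
  refine ⟨S.dot t v, S.dot_mem_socle ht hv, ?_⟩
  rw [dot_assoc, dot_assoc, ← S.dot_assoc t c v, (ht c).2, S.dot_assoc c t v]

theorem socle_rel_circ {a b c d : B} (h1 : S.socleSetoid.r a b) (h2 : S.socleSetoid.r c d) :
    S.socleSetoid.r (S.circ a c) (S.circ b d) := by
  rw [socle_rel_iff] at *
  obtain ⟨t, ht, rfl⟩ := h1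
  obtain ⟨v, hv, rfl⟩ := h2
  refine ⟨S.dot (S.lam a v) t, S.dot_mem_socle (S.lam_mem_socle hv a) ht, ?_⟩
  have h : S.circ (S.dot a t) (S.dot c v) = S.dot t (S.circ a (S.dot c v)) := by
    rw [← (ht a).2, ← (ht a).1, circ_assoc, (ht _).1]
  rw [h, (ht _).2, S.circ_eq a (S.dot c v), lam_dot, S.circ_eq a c]
  simp only [dot_assoc]

/-- The quotient of the group `(B, ·)` by the socle. -/
def socleDotCon : @Con B S.dotGroup.toMul :=
  letI := S.dotGroup
  { S.socleSetoid with mul' := fun h1 h2 => S.socle_rel_dot h1 h2 }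

/-- The quotient of the group `(B, ∘)` by the socle. -/
def socleCircCon : @Con B S.circGroup.toMul :=
  letI := S.circGroup
  { S.socleSetoid with mul' := fun h1 h2 => S.socle_rel_circ h1 h2 }

/-- The set `B / Soc(B)`. -/
def SocleQuotient : Type u := Quotient S.socleSetoid

/-- The factor skew left brace `B / Soc(B)`. -/
def socleQuotient : SkewLeftBrace S.SocleQuotient where
  dotGroup := letI := S.dotGroup; (inferInstance : Group S.socleDotCon.Quotient)
  circGroup := letI := S.circGroup; (inferInstance : Group S.socleCircCon.Quotient)
  compat := by
    intro a b c
    induction a using Quotient.inductionOn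
    induction b using Quotient.inductionOn
    induction c using Quotient.inductionOn
    exact congrArg (Quotient.mk S.socleSetoid) (S.compat _ _ _)

/-- The socle series `B₀ = B`, `Bₙ₊₁ = Bₙ / Soc(Bₙ)`. -/
def socleSeries : ℕ → (C : Type u) × SkewLeftBrace C
  | 0 => ⟨B, S⟩
  | n + 1 => ⟨(socleSeries n).2.SocleQuotient, (socleSeries n).2.socleQuotient⟩

/-- `(B, ·, ∘)` is nilpotent of class `n` if `n` is the least number with `|Bₙ| = 1`. -/
def IsNilpotentOfClass (n : ℕ) : Prop :=
  IsLeast {m : ℕ | Nat.card (S.socleSeries m).1 = 1} n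

end SkewLeftBrace

/-! ## The skew left brace structure of `G(X, r)` -/

namespace YBSolution

variable {X : Type u} (s : YBSolution X)

/-- The skew left brace `(G(X, r), ·, ∘)`: `∘` is the multiplication of the group `G(X, r)`, and `·`
is the multiplication of `A(X, r)` carried over by the canonical bijection `G(X, r) → A(X, r)`. -/
noncomputable def structureBrace : SkewLeftBrace s.StructureGroup where
  dotGroup := s.toDerived.group
  circGroup := inferInstance
  compat := by
    intro a b c
    show a * s.toDerived.symm (s.toDerived b * s.toDerived c) =
      s.toDerived.symm (s.toDerived (s.toDerived.symm (s.toDerived (a * b) *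
        s.toDerived (s.toDerived.symm (s.toDerived a)⁻¹))) * s.toDerived (a * c))
    apply s.toDerived.injective
    simp only [toDerived_mul, Equiv.apply_symm_apply, map_mul]
    group

/-- On the generators, `λ_x(y) = σ_x(y)`: this characterizes the structure of `G(X, r)`. -/
theorem structureBrace_lam_of (x y : X) :
    s.structureBrace.lam (s.ofG x) (s.ofG y) = s.ofG (s.sigma x y) := by
  apply s.structureBrace.dot_cancel (a := s.ofG x)
  rw [← SkewLeftBrace.circ_eq]
  apply s.toDerived.injective
  show s.toDerived (s.ofG x * s.ofG y) =
    s.toDerived (s.toDerived.symm (s.toDerived (s.ofG x) * s.toDerived (s.ofG (s.sigma x y))))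
  rw [Equiv.apply_symm_apply, toDerived_mul, toDerived_of, toDerived_of, toDerived_of, actHom_of,
    sigmaAut_of]

end YBSolution

/-!
Write `D : G(X, r) → A(X, r)` for the canonical bijection, so that
`D (g ∘ h) = D g · g (D h)` for the action of `G(X, r)` on `A(X, r)`.

The proof rests on one observation (`YBSolution.Invariant`). Let `f : A(X, r) → H` be a homomorphism
with `f (σ_x(y)) = f y = f (τ_x(y))` for all generators `x, y`. Then `f` is constant on the orbits
of `G(X, r)`, and the defining relation `x · y = y · σ_y σ̂_y⁻¹(x)`, in which
`σ̂_y⁻¹(x) = τ_{σ_x⁻¹(y)}(x)`, shows that `f` has commutative image. Consequently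
`f (D (a · b)) = f (D (b · a)) = f (D (a ∘ b))` for all `a, b`.

For a 2-reductive solution the braid relation says that all the permutations `σ_x`, `τ_y` commute
with one another. Then there are three invariant homomorphisms:

* `lamHom`, sending `x` to the automorphism `σ_x` of `A(X, r)`; composed with `D` it is `λ`;
* `tauHom`, sending `x` to the automorphism of the *group* `G(X, r)` extending `τ_x`; composed with
  `D` it is `ρ`, by the exchange law `a ∘ b = λ_a(b) ∘ ρ_b(a)` (`mul_eq_lam_mul_tauHom`);
* the conjugation homomorphism `A(X, r) → Aut A(X, r)`: conjugation by `y` permutes the generators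
  by `σ_y τ_y`, which depends only on `σ_y` and `τ_y`.

The first two give the identities for `λ` and `ρ`. An element on which the first and the third are
trivial lies in the socle, so `a · b`, `b · a` and `a ∘ b` have the same image in
`B₁ = G(X, r) / Soc`. Hence `B₁` is its own socle, and `B₂` is trivial.
-/

namespace YBSolution

variable {X : Type u} {s : YBSolution X}

/-! ### Commutation in a 2-reductive solution -/

namespace IsTwoReductive

theorem sigma_sigma (hs : s.IsTwoReductive) (x y : X) : s.sigma (s.sigma x y) = s.sigma y :=
  (hs x y).1

theorem tau_tau (hs : s.IsTwoReductive) (x y : X) : s.tau (s.tau x y) = s.tau y :=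
  (hs x y).2.1

theorem sigma_tau (hs : s.IsTwoReductive) (x y : X) : s.sigma (s.tau x y) = s.sigma y :=
  (hs x y).2.2.1

theorem tau_sigma (hs : s.IsTwoReductive) (x y : X) : s.tau (s.sigma x y) = s.tau y :=
  (hs x y).2.2.2

theorem sigma_comm (hs : s.IsTwoReductive) (x y z : X) :
    s.sigma x (s.sigma y z) = s.sigma y (s.sigma x z) := by
  rw [(s.braid_apply x y z).1, hs.sigma_sigma, hs.sigma_tau]

theorem sigma_tau_comm (hs : s.IsTwoReductive) (x y z : X) :
    s.sigma x (s.tau y z) = s.tau y (s.sigma x z) := by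
  have h := (s.braid_apply x z y).2.1
  rwa [hs.sigma_tau, hs.tau_sigma] at h

theorem tau_comm (hs : s.IsTwoReductive) (x y z : X) :
    s.tau x (s.tau y z) = s.tau y (s.tau x z) := by
  have h := (s.braid_apply z x y).2.2
  rwa [hs.tau_tau, hs.tau_sigma] at h

/-- `σ_y σ̂_y⁻¹ = σ_y τ_y`, so the relations of `A(X, r)` become `x · y = y · σ_y(τ_y(x))`. -/
theorem sigmaHat_symm (hs : s.IsTwoReductive) (x y : X) :
    (s.sigmaHat y).symm x = s.tau y x := by
  rw [sigmaHat_symm_apply]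
  obtain ⟨c, rfl⟩ := (s.sigma x).surjective y
  rw [Equiv.symm_apply_apply, hs.tau_sigma]

end IsTwoReductive

/-! ### Invariant homomorphisms on the derived group -/

/-- A homomorphism on `A(X, r)` is invariant if, on generators, it is constant along the
permutations `σ_x` and `τ_x`. -/
def Invariant {H : Type*} [Group H] (f : s.DerivedGroup →* H) : Prop :=
  ∀ x y : X, f (s.ofA (s.sigma x y)) = f (s.ofA y) ∧ f (s.ofA (s.tau x y)) = f (s.ofA y)

namespace Invariant

variable {H : Type*} [Group H] {f : s.DerivedGroup →* H}

theorem map_actHom (hf : Invariant f) (g : s.StructureGroup) (a : s.DerivedGroup) :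
    f (s.actHom g a) = f a := by
  suffices h : f.comp (s.actHom g).toMonoidHom = f from DFunLike.congr_fun h a
  refine s.inductionG (P := fun g => f.comp (s.actHom g).toMonoidHom = f) ?_ ?_ ?_ ?_ g
  · intro x
    ext y
    change f (s.actHom (s.ofG x) (s.ofA y)) = f (s.ofA y)
    rw [actHom_of, sigmaAut_of, (hf x y).1]
  · ext y
    simp
  · intro a b ha hb
    ext y
    change f (s.actHom (a * b) (s.ofA y)) = f (s.ofA y)
    rw [map_mul, MulAut.mul_apply]
    exact (DFunLike.congr_fun ha _).trans (DFunLike.congr_fun hb _)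
  · intro a ha
    ext y
    change f (s.actHom a⁻¹ (s.ofA y)) = f (s.ofA y)
    have h : f (s.actHom a (s.actHom a⁻¹ (s.ofA y))) = f (s.actHom a⁻¹ (s.ofA y)) :=
      DFunLike.congr_fun ha _
    rw [← h, ← MulAut.mul_apply, ← map_mul, mul_inv_cancel, map_one, MulAut.one_apply]

theorem map_commute (hf : Invariant f) (a b : s.DerivedGroup) : Commute (f a) (f b) := by
  refine s.inductionA (P := fun a => ∀ b, Commute (f a) (f b)) ?_ ?_ ?_ ?_ a b
  · intro x b
    refine s.inductionA (P := fun b => Commute (f (s.ofA x)) (f b)) ?_ ?_ ?_ ?_ b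
    · intro y
      have h := congrArg f (s.ofA_rel x y)
      rwa [map_mul, map_mul, (hf _ _).1, sigmaHat_symm_apply, (hf _ _).2] at h
    · rw [map_one]
      exact Commute.one_right _
    · intro b c hb hc
      rw [map_mul]
      exact hb.mul_right hc
    · intro b hb
      rw [map_inv]
      exact hb.inv_right
  · intro b
    rw [map_one]
    exact Commute.one_left _
  · intro a c ha hc b
    rw [map_mul]
    exact (ha b).mul_left (hc b)
  · intro a ha b
    rw [map_inv]
    exact (ha b).inv_left

theorem map_toDerived_mul (hf : Invariant f) (g h : s.StructureGroup) :
    f (s.toDerived (g * h)) = f (s.toDerived g) * f (s.toDerived h) := by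
  rw [toDerived_mul, map_mul, hf.map_actHom]

end Invariant

/-! ### The operations of the brace in terms of the derived group -/

theorem toDerived_dot (a b : s.StructureGroup) :
    s.toDerived (s.structureBrace.dot a b) = s.toDerived a * s.toDerived b :=
  Equiv.apply_symm_apply _ _

theorem toDerived_dotInv (a : s.StructureGroup) :
    s.toDerived (s.structureBrace.dotInv a) = (s.toDerived a)⁻¹ :=
  Equiv.apply_symm_apply _ _

theorem circ_eq_mul (a b : s.StructureGroup) : s.structureBrace.circ a b = a * b := rfl

theorem toDerived_lam (a b : s.StructureGroup) :
    s.toDerived (s.structureBrace.lam a b) = s.actHom a (s.toDerived b) := by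
  rw [SkewLeftBrace.lam, toDerived_dot, toDerived_dotInv, circ_eq_mul, toDerived_mul,
    inv_mul_cancel_left]

theorem lam_ofG (a : s.StructureGroup) (y : X) :
    s.structureBrace.lam a (s.ofG y) = s.ofG (s.sigmaHom a y) := by
  apply s.toDerived.injective
  rw [toDerived_lam, toDerived_of, toDerived_of, actHom_apply_of]

theorem Invariant.map_dot {H : Type*} [Group H] {f : s.DerivedGroup →* H} (hf : Invariant f)
    (a b : s.StructureGroup) :
    f (s.toDerived (s.structureBrace.dot a b)) =
      f (s.toDerived (s.structureBrace.circ a b)) := by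
  rw [toDerived_dot, map_mul, circ_eq_mul, hf.map_toDerived_mul]

theorem Invariant.map_dot_swap {H : Type*} [Group H] {f : s.DerivedGroup →* H} (hf : Invariant f)
    (a b : s.StructureGroup) :
    f (s.toDerived (s.structureBrace.dot b a)) =
      f (s.toDerived (s.structureBrace.circ a b)) := by
  rw [toDerived_dot, map_mul, (hf.map_commute _ _).eq, circ_eq_mul, hf.map_toDerived_mul]

namespace IsTwoReductive

/-! ### The homomorphism inducing `λ` -/

theorem sigmaAut_congr {x y : X} (h : s.sigma x = s.sigma y) : s.sigmaAut x = s.sigmaAut y := by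
  apply MulEquiv.toMonoidHom_injective
  ext z
  change s.sigmaAut x (s.ofA z) = s.sigmaAut y (s.ofA z)
  rw [sigmaAut_of, sigmaAut_of, h]

theorem sigmaAut_comm (hs : s.IsTwoReductive) (x y : X) :
    s.sigmaAut x * s.sigmaAut y = s.sigmaAut y * s.sigmaAut x := by
  apply MulEquiv.toMonoidHom_injective
  ext z
  change s.sigmaAut x (s.sigmaAut y (s.ofA z)) = s.sigmaAut y (s.sigmaAut x (s.ofA z))
  simp only [sigmaAut_of, hs.sigma_comm x y]

/-- The homomorphism `A(X, r) → Aut A(X, r)` sending a generator `x` to the extension of `σ_x`. -/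
def lamHom (hs : s.IsTwoReductive) : s.DerivedGroup →* MulAut s.DerivedGroup :=
  s.liftA s.sigmaAut (fun x y => by
    rw [hs.sigmaAut_comm, hs.sigmaHat_symm,
      sigmaAut_congr ((hs.sigma_sigma y (s.tau y x)).trans (hs.sigma_tau y x))])

theorem lamHom_of (hs : s.IsTwoReductive) (x : X) : hs.lamHom (s.ofA x) = s.sigmaAut x :=
  s.liftA_of _ _ x

theorem lamHom_invariant (hs : s.IsTwoReductive) : Invariant hs.lamHom := fun x y => by
  simp only [lamHom_of]
  exact ⟨sigmaAut_congr (hs.sigma_sigma x y), sigmaAut_congr (hs.sigma_tau x y)⟩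

theorem lamHom_toDerived (hs : s.IsTwoReductive) (g : s.StructureGroup) :
    hs.lamHom (s.toDerived g) = s.actHom g := by
  suffices h : MonoidHom.mk' (fun g => hs.lamHom (s.toDerived g))
      hs.lamHom_invariant.map_toDerived_mul = s.actHom from DFunLike.congr_fun h g
  ext1 x
  change hs.lamHom (s.toDerived (s.ofG x)) = s.actHom (s.ofG x)
  rw [toDerived_of, lamHom_of, actHom_of]

theorem actHom_lam (hs : s.IsTwoReductive) (a b : s.StructureGroup) :
    s.actHom (s.structureBrace.lam a b) = s.actHom b := by
  rw [← hs.lamHom_toDerived, toDerived_lam, hs.lamHom_invariant.map_actHom, hs.lamHom_toDerived]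

/-- For a 2-reductive solution the maps `λ_a` are automorphisms of `(G, ∘)` as well, because they
commute with one another and `λ_{λ_a(b)} = λ_b`. -/
theorem lam_mul (hs : s.IsTwoReductive) (a b c : s.StructureGroup) :
    s.structureBrace.lam a (b * c) = s.structureBrace.lam a b * s.structureBrace.lam a c := by
  apply s.toDerived.injective
  have hcomm : s.actHom a * s.actHom b = s.actHom b * s.actHom a := by
    rw [← hs.lamHom_toDerived, ← hs.lamHom_toDerived]
    exact hs.lamHom_invariant.map_commute _ _
  rw [toDerived_lam, toDerived_mul, map_mul, toDerived_mul, toDerived_lam, toDerived_lam,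
    hs.actHom_lam, ← MulAut.mul_apply, hcomm, MulAut.mul_apply]

theorem lam_inv (hs : s.IsTwoReductive) (a b : s.StructureGroup) :
    s.structureBrace.lam a b⁻¹ = (s.structureBrace.lam a b)⁻¹ :=
  map_inv (MonoidHom.mk' (s.structureBrace.lam a) (hs.lam_mul a)) b

theorem lam_congr {a b : s.StructureGroup} (h : s.actHom a = s.actHom b) :
    s.structureBrace.lam a = s.structureBrace.lam b := by
  funext c
  apply s.toDerived.injective
  rw [toDerived_lam, toDerived_lam, h]

/-! ### The homomorphism inducing `ρ` -/

/-- The endomorphism of `(G, ∘)` extending `τ_y`. -/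
def tauEnd (hs : s.IsTwoReductive) (y : X) : s.StructureGroup →* s.StructureGroup :=
  s.liftG (fun x => s.ofG (s.tau y x)) (fun x z => by
    rw [ofG_rel, hs.sigma_tau, hs.tau_tau, hs.sigma_tau_comm, hs.tau_comm])

theorem tauEnd_of (hs : s.IsTwoReductive) (y x : X) :
    hs.tauEnd y (s.ofG x) = s.ofG (s.tau y x) := s.liftG_of _ _ x

/-- The endomorphism of `(G, ∘)` extending `τ_y⁻¹`. -/
def tauEndInv (hs : s.IsTwoReductive) (y : X) : s.StructureGroup →* s.StructureGroup :=
  s.liftG (fun x => s.ofG ((s.tau y).symm x)) (fun x z => by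
    obtain ⟨x, rfl⟩ := (s.tau y).surjective x
    obtain ⟨z, rfl⟩ := (s.tau y).surjective z
    rw [hs.sigma_tau, hs.tau_tau, hs.sigma_tau_comm, hs.tau_comm z]
    simp only [Equiv.symm_apply_apply]
    exact s.ofG_rel x z)

theorem tauEndInv_of (hs : s.IsTwoReductive) (y x : X) :
    hs.tauEndInv y (s.ofG x) = s.ofG ((s.tau y).symm x) := s.liftG_of _ _ x

/-- The automorphism of `(G, ∘)` extending `τ_y`. -/
def tauAut (hs : s.IsTwoReductive) (y : X) : MulAut s.StructureGroup :=
  MonoidHom.toMulEquiv (hs.tauEnd y) (hs.tauEndInv y)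
    (by
      ext x
      change hs.tauEndInv y (hs.tauEnd y (s.ofG x)) = s.ofG x
      rw [tauEnd_of, tauEndInv_of, Equiv.symm_apply_apply])
    (by
      ext x
      change hs.tauEnd y (hs.tauEndInv y (s.ofG x)) = s.ofG x
      rw [tauEndInv_of, tauEnd_of, Equiv.apply_symm_apply])

theorem tauAut_of (hs : s.IsTwoReductive) (y x : X) :
    hs.tauAut y (s.ofG x) = s.ofG (s.tau y x) := hs.tauEnd_of y x

theorem tauAut_congr (hs : s.IsTwoReductive) {x y : X} (h : s.tau x = s.tau y) :
    hs.tauAut x = hs.tauAut y := by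
  apply MulEquiv.toMonoidHom_injective
  ext z
  change hs.tauAut x (s.ofG z) = hs.tauAut y (s.ofG z)
  rw [tauAut_of, tauAut_of, h]

theorem tauAut_comm (hs : s.IsTwoReductive) (x y : X) :
    hs.tauAut x * hs.tauAut y = hs.tauAut y * hs.tauAut x := by
  apply MulEquiv.toMonoidHom_injective
  ext z
  change hs.tauAut x (hs.tauAut y (s.ofG z)) = hs.tauAut y (hs.tauAut x (s.ofG z))
  simp only [tauAut_of, hs.tau_comm x y]

/-- The homomorphism `A(X, r) → Aut (G, ∘)` sending a generator `x` to the extension of `τ_x`. -/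
def tauHom (hs : s.IsTwoReductive) : s.DerivedGroup →* MulAut s.StructureGroup :=
  s.liftA hs.tauAut (fun x y => by
    rw [hs.tauAut_comm, hs.sigmaHat_symm,
      hs.tauAut_congr ((hs.tau_sigma y (s.tau y x)).trans (hs.tau_tau y x))])

theorem tauHom_of (hs : s.IsTwoReductive) (x : X) : hs.tauHom (s.ofA x) = hs.tauAut x :=
  s.liftA_of _ _ x

theorem tauHom_invariant (hs : s.IsTwoReductive) : Invariant hs.tauHom := fun x y => by
  simp only [tauHom_of]
  exact ⟨hs.tauAut_congr (hs.tau_sigma x y), hs.tauAut_congr (hs.tau_tau x y)⟩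

theorem actHom_tauHom (hs : s.IsTwoReductive) (b : s.DerivedGroup) (c : s.StructureGroup) :
    s.actHom (hs.tauHom b c) = s.actHom c := by
  refine s.inductionA (P := fun b => ∀ c, s.actHom (hs.tauHom b c) = s.actHom c) ?_ ?_ ?_ ?_ b c
  · intro x c
    suffices h : s.actHom.comp (hs.tauHom (s.ofA x)).toMonoidHom = s.actHom from
      DFunLike.congr_fun h c
    ext1 y
    change s.actHom (hs.tauHom (s.ofA x) (s.ofG y)) = s.actHom (s.ofG y)
    rw [tauHom_of, tauAut_of, actHom_of, actHom_of, sigmaAut_congr (hs.sigma_tau x y)]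
  · intro c
    rw [map_one, MulAut.one_apply]
  · intro a b ha hb c
    rw [map_mul, MulAut.mul_apply, ha, hb]
  · intro a ha c
    rw [← ha (hs.tauHom a⁻¹ c), ← MulAut.mul_apply, ← map_mul, mul_inv_cancel, map_one,
      MulAut.one_apply]

theorem mul_ofG_eq (hs : s.IsTwoReductive) (a : s.StructureGroup) (y : X) :
    a * s.ofG y = s.ofG (s.sigmaHom a y) * hs.tauAut y a := by
  have htau : ∀ (a : s.StructureGroup) (y : X), hs.tauAut (s.sigmaHom a y) = hs.tauAut y := by
    intro a y
    rw [← tauHom_of, ← actHom_apply_of, hs.tauHom_invariant.map_actHom, tauHom_of]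
  refine s.inductionG (P := fun a => ∀ y, a * s.ofG y = s.ofG (s.sigmaHom a y) * hs.tauAut y a)
    ?_ ?_ ?_ ?_ a y
  · intro x y
    rw [sigmaHom_of, tauAut_of, ofG_rel]
  · intro y
    simp
  · intro a b ha hb y
    rw [mul_assoc, hb, ← mul_assoc, ha, htau, map_mul, map_mul, Equiv.Perm.mul_apply, mul_assoc]
  · intro a ha y
    -- The law for `a` at `σ_a⁻¹(y)`, solved for `a⁻¹ ∘ y`.
    have h := ha (s.sigmaHom a⁻¹ y)
    rw [htau, map_inv, perm_apply_inv_apply] at h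
    rw [map_inv, map_inv, inv_mul_eq_iff_eq_mul, ← mul_assoc, h, mul_inv_cancel_right]

/-- The exchange law `a ∘ b = λ_a(b) ∘ ρ_b(a)`, with `ρ_b` replaced by the automorphism of `(G, ∘)`
that `tauHom` attaches to `b`. -/
theorem mul_eq_lam_mul_tauHom (hs : s.IsTwoReductive) (a b : s.StructureGroup) :
    a * b = s.structureBrace.lam a b * hs.tauHom (s.toDerived b) a := by
  have hlam : ∀ (b : s.DerivedGroup) (a : s.StructureGroup),
      s.structureBrace.lam (hs.tauHom b a) = s.structureBrace.lam a :=
    fun b a => lam_congr (hs.actHom_tauHom b a)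
  refine s.inductionG (P := fun b => ∀ a,
    a * b = s.structureBrace.lam a b * hs.tauHom (s.toDerived b) a) ?_ ?_ ?_ ?_ b a
  · intro y a
    rw [lam_ofG, toDerived_of, tauHom_of, hs.mul_ofG_eq]
  · intro a
    have h1 : s.toDerived 1 = 1 := s.cocycle_one
    have h2 : s.structureBrace.lam a 1 = 1 :=
      map_one (MonoidHom.mk' (s.structureBrace.lam a) (hs.lam_mul a))
    rw [h1, h2, map_one, MulAut.one_apply, mul_one, one_mul]
  · intro b c hb hc a
    rw [← mul_assoc, hb, mul_assoc, hc, hlam, hs.lam_mul, hs.tauHom_invariant.map_toDerived_mul,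
      (hs.tauHom_invariant.map_commute _ _).eq, MulAut.mul_apply, mul_assoc]
  · intro b hb a
    -- The law for `b` at the preimage of `a` under `tauHom b`, solved for `a ∘ b⁻¹`.
    have hinv : hs.tauHom (s.toDerived b⁻¹) = (hs.tauHom (s.toDerived b))⁻¹ :=
      map_inv (MonoidHom.mk' (fun g => hs.tauHom (s.toDerived g))
        hs.tauHom_invariant.map_toDerived_mul) b
    have h := hb (hs.tauHom (s.toDerived b⁻¹) a)
    rw [hlam, hinv, MulAut.apply_inv_self] at h
    rw [hs.lam_inv, hinv, mul_inv_eq_iff_eq_mul, mul_assoc, h, inv_mul_cancel_left]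

theorem rho_eq_tauHom (hs : s.IsTwoReductive) (b : s.StructureGroup) :
    s.structureBrace.rho b = hs.tauHom (s.toDerived b) := by
  funext a
  change (s.structureBrace.lam a b)⁻¹ * (a * b) = _
  rw [hs.mul_eq_lam_mul_tauHom a b, inv_mul_cancel_left]

/-! ### Conjugation in the derived group -/

theorem conj_ofA (hs : s.IsTwoReductive) (x y : X) :
    MulAut.conj (s.ofA y) (s.ofA (s.sigma y (s.tau y x))) = s.ofA x := by
  rw [MulAut.conj_apply, ← hs.sigmaHat_symm, ← ofA_rel, mul_inv_cancel_right]

theorem conj_congr (hs : s.IsTwoReductive) {y z : X} (h1 : s.sigma y = s.sigma z)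
    (h2 : s.tau y = s.tau z) : MulAut.conj (s.ofA y) = MulAut.conj (s.ofA z) := by
  apply MulEquiv.toMonoidHom_injective
  ext x
  obtain ⟨x, rfl⟩ := (s.sigma y).surjective x
  obtain ⟨x, rfl⟩ := (s.tau y).surjective x
  change MulAut.conj (s.ofA y) (s.ofA (s.sigma y (s.tau y x))) =
    MulAut.conj (s.ofA z) (s.ofA (s.sigma y (s.tau y x)))
  rw [conj_ofA hs, h1, h2, conj_ofA hs]

theorem conj_invariant (hs : s.IsTwoReductive) :
    Invariant (MulAut.conj (G := s.DerivedGroup)) := fun x y =>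
  ⟨hs.conj_congr (hs.sigma_sigma x y) (hs.tau_sigma x y),
    hs.conj_congr (hs.sigma_tau x y) (hs.tau_tau x y)⟩

/-! ### The socle series -/

/-- `a` lies in the socle as soon as `λ_a` and conjugation by `a` in `(G, ·)` are trivial. -/
theorem mem_socle {a : s.StructureGroup} (h1 : s.actHom a = 1)
    (h2 : MulAut.conj (s.toDerived a) = 1) : a ∈ s.structureBrace.socle := by
  intro b
  constructor
  · apply s.toDerived.injective
    rw [circ_eq_mul, toDerived_mul, toDerived_dot, h1, MulAut.one_apply]
  · apply s.toDerived.injective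
    have h := DFunLike.congr_fun h2 (s.toDerived b)
    rw [MulAut.conj_apply, MulAut.one_apply, mul_inv_eq_iff_eq_mul] at h
    rw [toDerived_dot, toDerived_dot, h]

/-- Two elements that no invariant homomorphism separates lie in the same coset of the socle. -/
theorem socle_rel (hs : s.IsTwoReductive) {a b : s.StructureGroup}
    (h : ∀ {H : Type u} [Group H] (f : s.DerivedGroup →* H), Invariant f →
      f (s.toDerived a) = f (s.toDerived b)) :
    s.structureBrace.socleSetoid.r a b := by
  apply mem_socle
  · rw [← hs.lamHom_toDerived, toDerived_dot, toDerived_dotInv, map_mul, map_inv,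
      h _ hs.lamHom_invariant, inv_mul_cancel]
  · rw [toDerived_dot, toDerived_dotInv, map_mul, map_inv, h _ hs.conj_invariant, inv_mul_cancel]

theorem socle_socleQuotient (hs : s.IsTwoReductive) (a : s.structureBrace.SocleQuotient) :
    a ∈ s.structureBrace.socleQuotient.socle := by
  intro b
  induction a using Quotient.inductionOn with | _ a
  induction b using Quotient.inductionOn with | _ b
  constructor
  · exact Quotient.sound (s := s.structureBrace.socleSetoid)
      (hs.socle_rel fun _ hf => (hf.map_dot a b).symm)
  · exact Quotient.sound (s := s.structureBrace.socleSetoid)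
      (hs.socle_rel fun _ hf => (hf.map_dot a b).trans (hf.map_dot_swap a b).symm)

theorem card_socleSeries_two (hs : s.IsTwoReductive) :
    Nat.card (s.structureBrace.socleSeries 2).1 = 1 := by
  change Nat.card s.structureBrace.socleQuotient.SocleQuotient = 1
  have : Subsingleton s.structureBrace.socleQuotient.SocleQuotient := by
    refine ⟨fun a b => ?_⟩
    induction a using Quotient.inductionOn
    induction b using Quotient.inductionOn
    exact Quotient.sound (hs.socle_socleQuotient _)
  have : Nonempty s.structureBrace.socleQuotient.SocleQuotient :=
    ⟨Quotient.mk _ (Quotient.mk _ 1)⟩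
  exact Nat.card_eq_one_iff_unique.mpr ⟨inferInstance, inferInstance⟩

end IsTwoReductive

end YBSolution

theorem mainTheorem6 {X : Type u} (s : YBSolution X) (hs : s.IsTwoReductive) :
    (∃ n : ℕ, n ≤ 2 ∧ s.structureBrace.IsNilpotentOfClass n) ∧
    (∀ a b : s.StructureGroup,
      s.structureBrace.lam (s.structureBrace.dot a b) =
          s.structureBrace.lam (s.structureBrace.circ a b) ∧
      s.structureBrace.lam (s.structureBrace.dot b a) =
          s.structureBrace.lam (s.structureBrace.circ a b) ∧
      s.structureBrace.rho (s.structureBrace.dot a b) =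
          s.structureBrace.rho (s.structureBrace.circ a b) ∧
      s.structureBrace.rho (s.structureBrace.dot b a) =
          s.structureBrace.rho (s.structureBrace.circ a b)) := by
  refine ⟨?_, fun a b => ?_⟩
  · have h := hs.card_socleSeries_two
    -- The class is the least index of a trivial term, which exists since the term of index 2 is.
    classical
    exact ⟨Nat.find ⟨2, h⟩, Nat.find_le h, Nat.find_spec ⟨2, h⟩, fun m hm => Nat.find_le hm⟩
  · simp only [hs.rho_eq_tauHom]
    refine ⟨YBSolution.IsTwoReductive.lam_congr ?_, YBSolution.IsTwoReductive.lam_congr ?_,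
      congrArg _ (hs.tauHom_invariant.map_dot a b),
      congrArg _ (hs.tauHom_invariant.map_dot_swap a b)⟩
    · rw [← hs.lamHom_toDerived, ← hs.lamHom_toDerived, hs.lamHom_invariant.map_dot]
    · rw [← hs.lamHom_toDerived, ← hs.lamHom_toDerived, hs.lamHom_invariant.map_dot_swap]
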